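/- Let $\tilde{\mathcal A}$ be the $\mathbb C$-algebra of series $\sum_{\nu\ge 0}P_\nu(a)\,b^\nu$ with $P_\nu\in\mathbb C[z]$, with the relation $ab-ba=b^2$ and with left and right multiplication by $a$ continuous for the $b$-adic topology. An (a,b)-module is a left $\tilde{\mathcal A}$-module that is free of finite rank over $\mathbb C[[b]]\subset\tilde{\mathcal A}$. It is regular if it embeds $\tilde{\mathcal A}$-linearly in an (a,b)-module $G$ with $aG\subset bG$, and monogenic if it is isomorphic to $\tilde{\mathcal A}/I$ for a left ideal $I$. For $\lambda\in\mathbb C$ put $E_\lambda=\tilde{\mathcal A}/\tilde{\mathcal A}(a-\lambda b)$. Theorem. Let $E$ be a monogenic regular (a,b)-module of rank $k\ge 1$, let $0=F_0\subset F_1\subset\cdots\subset F_k=E$ be a Jordan–Hölder series of $E$, that is, a chain of $\tilde{\mathcal A}$-submodules with $F_j/F_{j-1}\simeq E_{\lambda_j}$, $\lambda_j\in\mathbb C$, for $j\in[1,k]$. For $j\in[1,k-1]$ let $$m_j=\sup\{\lambda_h-\lambda_j \;:\; h\in[j+1,k],\ \lambda_h-\lambda_j\in\mathbb N\}$$ if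 this set is non-empty, and $m_j=-1$ otherwise (here $0\in\mathbb N$). Then there exist polynomials $S_1,\dots,S_{k-1}\in\mathbb C[b]$ with $S_j(0)=1$ and $\deg S_j\le k-j+m_j$ for all $j\in[1,k-1]$ such that $E$ is isomorphic, as a left $\tilde{\mathcal A}$-module, to $\tilde{\mathcal A}/\tilde{\mathcal A}\,\Pi$, where $$\Pi=(a-\lambda_1b)\,S_1^{-1}(a-\lambda_2b)\,S_2^{-1}\cdots(a-\lambda_{k-1}b)\,S_{k-1}^{-1}(a-\lambda_kb),$$ the inverses being taken in $\mathbb C[[b]]$. In particular $\deg S_j\le k-j-1$ for every $j\in[1,k-1]$ such that $\lambda_j\notin\lambda_h-\mathbb N$ for all $h\in[j+1,k]$. -/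

import Mathlib

open scoped Polynomial PowerSeries

/-- The algebra `Ã`, the `b`-adically complete `ℂ`-algebra with `a b - b a = b ^ 2`.
An element `x` stands for the series `∑ ν, b ^ ν * (x.coeff ν)(a)`.  (As
`b ^ ν * Ã = Ã * b ^ ν`, these are the same elements as the series `∑ ν, P ν (a) * b ^ ν`.) -/
@[ext] structure ATilde : Type where
  /-- The polynomial in `a` that is the coefficient of `b ^ ν`. -/
  coeff : ℕ → ℂ[X]

namespace ATilde

/-- `Ã` as a vector space. -/
def equivFun : ATilde ≃ (ℕ → ℂ[X]) where
  toFun := coeff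
  invFun := mk
  left_inv _ := rfl
  right_inv _ := rfl

noncomputable instance : AddCommGroup ATilde := equivFun.addCommGroup

noncomputable instance : Module ℂ ATilde := equivFun.module ℂ

theorem ext_coeff {x y : ATilde} (h : ∀ n, x.coeff n = y.coeff n) : x = y :=
  ATilde.ext (funext h)

theorem coeff_add (x y : ATilde) (n : ℕ) : (x + y).coeff n = x.coeff n + y.coeff n := rfl

theorem coeff_zero (n : ℕ) : (0 : ATilde).coeff n = 0 := rfl

theorem coeff_smul (c : ℂ) (x : ATilde) (n : ℕ) : (c • x).coeff n = c • x.coeff n := rfl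

/-- The relation `a b - b a = b ^ 2` forces
`P(a) * b ^ n = ∑ i, n (n + 1) ⋯ (n + i - 1) b ^ (n + i) * (P ^ (i) / i !)(a)`,
and therefore, by `b`-adic continuity,
`(∑ m, b ^ m * P m (a)) * (∑ n, b ^ n * Q n (a))
  = ∑ m n i, n (n + 1) ⋯ (n + i - 1) b ^ (m + n + i) * ((P m) ^ (i) / i ! * Q n)(a)`. -/
noncomputable instance : Mul ATilde where
  mul x y := .mk fun N =>
    ∑ p ∈ Finset.HasAntidiagonal.antidiagonal N, ∑ q ∈ Finset.HasAntidiagonal.antidiagonal p.2,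
      (q.1.ascFactorial q.2) • (Polynomial.hasseDeriv q.2 (x.coeff p.1) * y.coeff q.1)

noncomputable instance : One ATilde where
  one := .mk fun n => if n = 0 then 1 else 0

theorem coeff_one (n : ℕ) : (1 : ATilde).coeff n = if n = 0 then 1 else 0 := rfl

theorem coeff_mul (x y : ATilde) (N : ℕ) : (x * y).coeff N =
    ∑ p ∈ Finset.HasAntidiagonal.antidiagonal N, ∑ q ∈ Finset.HasAntidiagonal.antidiagonal p.2,
      (q.1.ascFactorial q.2) • (Polynomial.hasseDeriv q.2 (x.coeff p.1) * y.coeff q.1) := rfl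

/-- Vandermonde's identity for rising factorials. -/
theorem ascFactorial_add_eq_sum (m n s : ℕ) : (m + n).ascFactorial s =
    ∑ t ∈ Finset.HasAntidiagonal.antidiagonal s,
      s.choose t.1 * (m.ascFactorial t.1 * n.ascFactorial t.2) := by
  induction s generalizing m n with
  | zero => simp
  | succ s ih =>
    have h := Finset.sum_antidiagonal_choose_succ_mul (R := ℕ)
      (fun i j => m.ascFactorial i * n.ascFactorial j) s
    simp only [Nat.cast_id] at h
    rw [h, Nat.ascFactorial_succ, ih, Finset.mul_sum, ← Finset.sum_add_distrib]
    refine Finset.sum_congr rfl ?_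
    rintro ⟨i, j⟩ hij
    rw [Finset.HasAntidiagonal.mem_antidiagonal] at hij
    dsimp only at hij ⊢
    subst hij
    rw [Nat.choose_symm_add, Nat.ascFactorial_succ, Nat.ascFactorial_succ]
    ring

theorem mul_assoc' (x y z : ATilde) : x * y * z = x * (y * z) := by
  refine ext_coeff fun N => ?_
  have hL : (x * y * z).coeff N = ∑ p ∈ Finset.HasAntidiagonal.antidiagonal N, ∑ q ∈ Finset.HasAntidiagonal.antidiagonal p.2,
      ∑ r ∈ Finset.HasAntidiagonal.antidiagonal p.1, ∑ t ∈ Finset.HasAntidiagonal.antidiagonal r.2,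
      ∑ w ∈ Finset.HasAntidiagonal.antidiagonal q.2,
        (q.1.ascFactorial q.2 * (t.1.ascFactorial t.2 * (w.1 + t.2).choose w.1)) •
          (Polynomial.hasseDeriv (w.1 + t.2) (x.coeff r.1) *
            Polynomial.hasseDeriv w.2 (y.coeff t.1) * z.coeff q.1) := by
    simp only [coeff_mul, map_sum, map_nsmul, Polynomial.hasseDeriv_mul, Finset.sum_mul,
      Finset.smul_sum, smul_mul_assoc, smul_smul]
    refine Finset.sum_congr rfl fun p _ => Finset.sum_congr rfl fun q _ =>
      Finset.sum_congr rfl fun r _ => Finset.sum_congr rfl fun t _ =>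
      Finset.sum_congr rfl fun w _ => ?_
    have h := LinearMap.congr_fun (Polynomial.hasseDeriv_comp (R := ℂ) w.1 t.2) (x.coeff r.1)
    simp only [LinearMap.comp_apply, LinearMap.smul_apply] at h
    rw [h]
    simp only [smul_mul_assoc, smul_smul, mul_assoc]
  have hR : (x * (y * z)).coeff N = ∑ p ∈ Finset.HasAntidiagonal.antidiagonal N, ∑ q ∈ Finset.HasAntidiagonal.antidiagonal p.2,
      ∑ r ∈ Finset.HasAntidiagonal.antidiagonal q.1, ∑ t ∈ Finset.HasAntidiagonal.antidiagonal r.2,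
      ∑ w ∈ Finset.HasAntidiagonal.antidiagonal q.2,
        (t.1.ascFactorial (w.1 + t.2) * (r.1.ascFactorial w.2 * q.2.choose w.1)) •
          (Polynomial.hasseDeriv q.2 (x.coeff p.1) *
            Polynomial.hasseDeriv t.2 (y.coeff r.1) * z.coeff t.1) := by
    simp only [coeff_mul, Finset.smul_sum, Finset.mul_sum]
    refine Finset.sum_congr rfl fun p _ => Finset.sum_congr rfl fun q _ =>
      Finset.sum_congr rfl fun r hr => Finset.sum_congr rfl fun t ht => ?_
    rw [Finset.HasAntidiagonal.mem_antidiagonal] at hr ht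
    rw [← Finset.sum_smul, mul_smul_comm, smul_smul, mul_assoc]
    congr 1
    have e : q.1 = (t.1 + t.2) + r.1 := by omega
    rw [e, ascFactorial_add_eq_sum, Finset.sum_mul]
    refine Finset.sum_congr rfl fun w _ => ?_
    rw [add_comm w.1 t.2, ← Nat.ascFactorial_mul_ascFactorial]
    ring
  rw [hL, hR]
  simp only [Finset.sum_sigma']
  refine Finset.sum_bij'
    (fun v _ => ⟨(v.2.2.1.1, v.2.2.2.1.1 + (v.2.1.1 + v.2.2.2.2.2) +
        (v.2.2.2.2.1 + v.2.2.2.1.2)),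
      ⟨(v.2.2.2.1.1 + (v.2.1.1 + v.2.2.2.2.2), v.2.2.2.2.1 + v.2.2.2.1.2),
      ⟨(v.2.2.2.1.1, v.2.1.1 + v.2.2.2.2.2),
      ⟨(v.2.1.1, v.2.2.2.2.2), (v.2.2.2.2.1, v.2.2.2.1.2)⟩⟩⟩⟩)
    (fun v _ => ⟨(v.1.1 + (v.2.2.1.1 + v.2.2.2.2.2),
        v.2.2.2.1.1 + (v.2.2.2.2.1 + v.2.2.2.1.2)),
      ⟨(v.2.2.2.1.1, v.2.2.2.2.1 + v.2.2.2.1.2),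
      ⟨(v.1.1, v.2.2.1.1 + v.2.2.2.2.2),
      ⟨(v.2.2.1.1, v.2.2.2.2.2), (v.2.2.2.2.1, v.2.2.2.1.2)⟩⟩⟩⟩)
    ?_ ?_ ?_ ?_ ?_
  · rintro ⟨⟨p1, p2⟩, ⟨q1, q2⟩, ⟨r1, r2⟩, ⟨t1, t2⟩, ⟨w1, w2⟩⟩ h
    simp only [Finset.mem_sigma, Finset.HasAntidiagonal.mem_antidiagonal] at h ⊢
    obtain ⟨h1, h2, h3, h4, h5⟩ := h
    subst h5 h4 h3 h2 h1
    exact ⟨by ring, by trivial, by trivial, by trivial, by trivial⟩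
  · rintro ⟨⟨p1, p2⟩, ⟨q1, q2⟩, ⟨r1, r2⟩, ⟨t1, t2⟩, ⟨w1, w2⟩⟩ h
    simp only [Finset.mem_sigma, Finset.HasAntidiagonal.mem_antidiagonal] at h ⊢
    obtain ⟨h1, h2, h3, h4, h5⟩ := h
    subst h5 h4 h3 h2 h1
    exact ⟨by ring, by trivial, by trivial, by trivial, by trivial⟩
  · rintro ⟨⟨p1, p2⟩, ⟨q1, q2⟩, ⟨r1, r2⟩, ⟨t1, t2⟩, ⟨w1, w2⟩⟩ h
    simp only [Finset.mem_sigma, Finset.HasAntidiagonal.mem_antidiagonal] at h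
    obtain ⟨h1, h2, h3, h4, h5⟩ := h
    subst h5 h4 h3 h2 h1
    rfl
  · rintro ⟨⟨p1, p2⟩, ⟨q1, q2⟩, ⟨r1, r2⟩, ⟨t1, t2⟩, ⟨w1, w2⟩⟩ h
    simp only [Finset.mem_sigma, Finset.HasAntidiagonal.mem_antidiagonal] at h
    obtain ⟨h1, h2, h3, h4, h5⟩ := h
    subst h5 h4 h3 h2 h1
    rfl
  · rintro ⟨⟨p1, p2⟩, ⟨q1, q2⟩, ⟨r1, r2⟩, ⟨t1, t2⟩, ⟨w1, w2⟩⟩ h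
    simp only [Finset.mem_sigma, Finset.HasAntidiagonal.mem_antidiagonal] at h
    obtain ⟨h1, h2, h3, h4, h5⟩ := h
    subst h5 h4 h3 h2 h1
    dsimp only

theorem one_mul' (x : ATilde) : 1 * x = x := by
  refine ext_coeff fun N => ?_
  rw [coeff_mul, Finset.sum_eq_single (0, N)]
  · rw [Finset.sum_eq_single (N, 0)]
    · simp [coeff_one]
    · rintro ⟨n, i⟩ h hne
      have hi : i ≠ 0 := by
        rintro rfl
        simp at h
        simp [h] at hne
      have : Polynomial.hasseDeriv i (1 : ℂ[X]) = 0 :=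
        Polynomial.hasseDeriv_apply_one i (Nat.pos_of_ne_zero hi)
      simp [coeff_one, this]
    · simp
  · rintro ⟨m, r⟩ h hne
    have hm : m ≠ 0 := by
      rintro rfl
      simp at h
      simp [h] at hne
    simp [coeff_one, hm]
  · simp

theorem mul_one' (x : ATilde) : x * 1 = x := by
  refine ext_coeff fun N => ?_
  rw [coeff_mul, Finset.sum_eq_single (N, 0)]
  · simp [coeff_one]
  · rintro ⟨m, r⟩ h hne
    have hr : r ≠ 0 := by
      rintro rfl
      simp at h
      simp [h] at hne
    refine Finset.sum_eq_zero ?_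
    rintro ⟨n, i⟩ h'
    rw [Finset.HasAntidiagonal.mem_antidiagonal] at h'
    dsimp only at h' ⊢
    rcases Nat.eq_zero_or_pos n with rfl | hn
    · obtain ⟨j, rfl⟩ : ∃ j, i = j + 1 := ⟨i - 1, by omega⟩
      simp [Nat.zero_ascFactorial]
    · simp [coeff_one, hn.ne']
  · simp

noncomputable instance : Ring ATilde :=
  { (inferInstance : AddCommGroup ATilde), (inferInstance : Mul ATilde),
    (inferInstance : One ATilde) with
    mul_assoc := mul_assoc'
    one_mul := one_mul'
    mul_one := mul_one'
    left_distrib := fun x y z => by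
      refine ext_coeff fun N => ?_
      simp only [coeff_mul, coeff_add, mul_add, smul_add, Finset.sum_add_distrib]
    right_distrib := fun x y z => by
      refine ext_coeff fun N => ?_
      simp only [coeff_mul, coeff_add, map_add, add_mul, smul_add, Finset.sum_add_distrib]
    zero_mul := fun x => by
      refine ext_coeff fun N => ?_
      simp [coeff_mul, coeff_zero]
    mul_zero := fun x => by
      refine ext_coeff fun N => ?_
      simp [coeff_mul, coeff_zero] }

noncomputable instance : Algebra ℂ ATilde :=
  Algebra.ofModule
    (fun c x y => by
      refine ext_coeff fun N => ?_
      simp only [coeff_mul, coeff_smul, map_smul, smul_mul_assoc, Finset.smul_sum]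
      exact Finset.sum_congr rfl fun p _ => Finset.sum_congr rfl fun q _ => smul_comm _ _ _)
    (fun c x y => by
      refine ext_coeff fun N => ?_
      simp only [coeff_mul, coeff_smul, mul_smul_comm, Finset.smul_sum]
      exact Finset.sum_congr rfl fun p _ => Finset.sum_congr rfl fun q _ => smul_comm _ _ _)

/-- The generator `a`. -/
noncomputable def a : ATilde := .mk fun n => if n = 0 then Polynomial.X else 0

/-- The generator `b`. -/
noncomputable def b : ATilde := .mk fun n => if n = 1 then 1 else 0

theorem coeff_a (n : ℕ) : a.coeff n = if n = 0 then Polynomial.X else 0 := rfl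

theorem coeff_b (n : ℕ) : b.coeff n = if n = 1 then 1 else 0 := rfl

theorem coeff_b_mul_succ (x : ATilde) (N : ℕ) : (b * x).coeff (N + 1) = x.coeff N := by
  rw [coeff_mul, Finset.sum_eq_single (1, N)]
  · rw [Finset.sum_eq_single (N, 0)]
    · simp [coeff_b]
    · rintro ⟨n, i⟩ h hne
      have hi : i ≠ 0 := by
        rintro rfl
        simp at h
        simp [h] at hne
      have : Polynomial.hasseDeriv i (1 : ℂ[X]) = 0 :=
        Polynomial.hasseDeriv_apply_one i (Nat.pos_of_ne_zero hi)
      simp [coeff_b, this]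
    · simp
  · rintro ⟨m, r⟩ h hne
    have hm : m ≠ 1 := by
      rintro rfl
      rw [Finset.HasAntidiagonal.mem_antidiagonal] at h
      exact hne (by ext <;> simp; omega)
    simp [coeff_b, hm]
  · simp [add_comm]

theorem coeff_b_mul_zero (x : ATilde) : (b * x).coeff 0 = 0 := by
  simp [coeff_mul, coeff_b]

theorem a_mul_b_sub_b_mul_a : a * b - b * a = b ^ 2 := by
  rw [sub_eq_iff_eq_add, pow_two]
  refine ext_coeff fun N => ?_
  rw [coeff_add]
  match N with
  | 0 => simp [coeff_mul, coeff_a, coeff_b]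
  | N + 1 =>
    rw [coeff_b_mul_succ, coeff_b_mul_succ, coeff_mul, Finset.sum_eq_single (0, N + 1)]
    · rw [Finset.sum_eq_single (1, N)]
      · match N with
        | 0 => simp [coeff_a, coeff_b]
        | 1 => simp [coeff_a, coeff_b, Polynomial.hasseDeriv_one]
        | N + 2 => simp [coeff_a, coeff_b, Polynomial.hasseDeriv_X (N + 2) (by omega)]
      · rintro ⟨n, i⟩ h hne
        have hn : n ≠ 1 := by
          rintro rfl
          rw [Finset.HasAntidiagonal.mem_antidiagonal] at h
          exact hne (by ext <;> simp; omega)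
        simp [coeff_b, hn]
      · simp [add_comm]
    · rintro ⟨m, r⟩ h hne
      have hm : m ≠ 0 := by
        rintro rfl
        simp at h
        simp [h] at hne
      simp [coeff_a, hm]
    · simp

/-- The inclusion of the subalgebra `ℂ[[b]]`, sending `∑ c n X ^ n` to `∑ c n b ^ n`. -/
noncomputable def ofSeries : ℂ⟦X⟧ →+* ATilde where
  toFun f := .mk fun n => Polynomial.C (PowerSeries.coeff n f)
  map_one' := by
    refine ext_coeff fun n => ?_
    simp only [coeff_one, PowerSeries.coeff_one]
    split_ifs <;> simp
  map_zero' := by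
    refine ext_coeff fun n => ?_
    simp [coeff_zero]
  map_add' f g := by
    refine ext_coeff fun n => ?_
    simp [coeff_add]
  map_mul' f g := by
    refine ext_coeff fun N => ?_
    simp only [coeff_mul, PowerSeries.coeff_mul, map_sum]
    refine Finset.sum_congr rfl ?_
    rintro ⟨m, r⟩ _
    dsimp only
    rw [Finset.sum_eq_single (r, 0)]
    · simp
    · rintro ⟨n, i⟩ h hne
      have hi : i ≠ 0 := by
        rintro rfl
        simp at h
        simp [h] at hne
      simp [Polynomial.hasseDeriv_C i _ (Nat.pos_of_ne_zero hi)]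
    · simp

end ATilde

universe u

/-- An (a,b)-module: a left `Ã`-module that is free of finite type over `ℂ[[b]]`. -/
def IsABModule (E : Type u) [AddCommGroup E] [Module ATilde E] : Prop :=
  letI : Module ℂ⟦X⟧ E := Module.compHom E ATilde.ofSeries
  Module.Free ℂ⟦X⟧ E ∧ Module.Finite ℂ⟦X⟧ E

/-- `E` has a simple pole: `a E ⊆ b E`. -/
def HasSimplePole (E : Type u) [AddCommGroup E] [Module ATilde E] : Prop :=
  ∀ x : E, ∃ y : E, ATilde.a • x = ATilde.b • y

/-- A regular (a,b)-module: an (a,b)-module that embeds in an (a,b)-module with a simple pole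
(equivalently, its saturation by `b⁻¹ a` in `E[b⁻¹]` is of finite type over `ℂ[[b]]`). -/
def IsRegularABModule (E : Type u) [AddCommGroup E] [Module ATilde E] : Prop :=
  IsABModule E ∧
    ∃ (G : Type u) (_ : AddCommGroup G) (_ : Module ATilde G),
      IsABModule G ∧ HasSimplePole G ∧ ∃ f : E →ₗ[ATilde] G, Function.Injective f

/-- `E` is monogenic: isomorphic to `Ã / I` for some left ideal `I`. -/
def IsMonogenic (E : Type u) [AddCommGroup E] [Module ATilde E] : Prop :=
  ∃ I : Submodule ATilde ATilde, Nonempty (E ≃ₗ[ATilde] ATilde ⧸ I)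

/-- The left `Ã`-module `Ã / Ã P`. -/
abbrev QuotBy (P : ATilde) : Type := ATilde ⧸ Submodule.span ATilde {P}

/-- The rank one (a,b)-module `E_μ = Ã / Ã (a - μ b)`. -/
abbrev ELam (μ : ℂ) : Type := QuotBy (ATilde.a - μ • ATilde.b)

/-- `0 = F 0 ⊆ F 1 ⊆ ⋯ ⊆ F k = E` is a Jordan-Hölder series of `E` whose successive quotients
`F 1 / F 0, …, F k / F (k - 1)` are isomorphic to `E_(lam 0), …, E_(lam (k - 1))`. -/
structure IsJordanHolderSeries {E : Type u} [AddCommGroup E] [Module ATilde E] {k : ℕ}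
    (F : Fin (k + 1) → Submodule ATilde E) (lam : Fin k → ℂ) : Prop where
  bot : F 0 = ⊥
  top : F (Fin.last k) = ⊤
  le : ∀ j : Fin k, F j.castSucc ≤ F j.succ
  quot : ∀ j : Fin k,
    Nonempty ((F j.succ ⧸ (F j.castSucc).submoduleOf (F j.succ)) ≃ₗ[ATilde] ELam (lam j))

open Classical in
/-- The largest natural number of the form `lam h - lam j` with `h > j`,
and `-1` if there is none. -/
noncomputable def mExp {k : ℕ} (lam : Fin k → ℂ) (j : Fin k) : ℤ :=
  if {p : ℕ | ∃ h : Fin k, j < h ∧ lam h - lam j = p}.Nonempty then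
    ((sSup {p : ℕ | ∃ h : Fin k, j < h ∧ lam h - lam j = p} : ℕ) : ℤ)
  else -1

/-- The product `(a - lam 0 b) (S 0)⁻¹ (a - lam 1 b) (S 1)⁻¹ ⋯ (S (n - 1))⁻¹ (a - lam n b)`,
the inverses being taken in `ℂ[[b]]`. -/
noncomputable def PiProd {n : ℕ} (lam : Fin (n + 1) → ℂ) (S : Fin n → ℂ[X]) : ATilde :=
  (List.ofFn fun j : Fin n =>
      (ATilde.a - lam j.castSucc • ATilde.b) * ATilde.ofSeries ((S j : ℂ⟦X⟧)⁻¹)).prod *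
    (ATilde.a - lam (Fin.last n) • ATilde.b)

/-! ### Coefficients and the augmentation -/

namespace ATilde

/-! The generator is lifted down the Jordan–Hölder chain, starting from the top quotient. Suppose
`e` generates `E` modulo `F₁` with annihilator `Ã P`, and let `f` generate `F₁ / F₀ ≃ E_μ`. Then `P
e ∈ F₁`, and division by `a - μ b` (`exists_eq_mul_add_ofSeries`) gives `P e = S f` modulo `F₀` with
`S ∈ ℂ[[b]]`.

Since `E` is cyclic, `S` must be a unit: otherwise `e` and `f` would be independent generators
modulo `a` and `b`. The augmentation detects this, and rescaling `f` gives `S(0) = 1`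
(`exists_generator_normalized`). Hence `f = S⁻¹ P e` modulo `F₀`, so `e` generates `E` modulo `F₀`
with annihilator `Ã (a - μ b) S⁻¹ P`.

To make `S` a polynomial, replace `e` by `e + T f` with `T ∈ ℂ[[b]]`, which adds `P T f` to `S f`.
In `E_μ`, `a - ν b` sends `b^q` to `(μ + q - ν) b^(q+1)`, which vanishes only when `q = ν - μ`. From
order `m + 1` on, no factor of `P` meets such a resonance, and each factor raises the order by one;
so every series of order at least `m + 1` plus the number of factors is attained
(`exists_piProd_mul_ofSeries_sub_mem`), and `S` can be truncated there. -/

theorem coeff_sub (x y : ATilde) (n : ℕ) : (x - y).coeff n = x.coeff n - y.coeff n := rfl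

theorem coeff_mul_zero (x y : ATilde) : (x * y).coeff 0 = x.coeff 0 * y.coeff 0 := by
  simp [coeff_mul]

theorem coeff_ofSeries (f : ℂ⟦X⟧) (n : ℕ) :
    (ofSeries f).coeff n = Polynomial.C (PowerSeries.coeff n f) := rfl

/-- The augmentation of `Ã`, which sends `a` and `b` to `0`. -/
noncomputable def augmentation : ATilde →+* ℂ where
  toFun x := (x.coeff 0).eval 0
  map_one' := by simp [coeff_one]
  map_zero' := by simp [coeff_zero]
  map_add' x y := by simp [coeff_add]
  map_mul' x y := by simp [coeff_mul_zero]

theorem augmentation_apply (x : ATilde) : augmentation x = (x.coeff 0).eval 0 := rfl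

theorem augmentation_sub_smul (μ : ℂ) : augmentation (a - μ • b) = 0 := by
  simp [augmentation_apply, coeff_sub, coeff_smul, coeff_a, coeff_b]

theorem augmentation_ofSeries (f : ℂ⟦X⟧) :
    augmentation (ofSeries f) = PowerSeries.constantCoeff f := by
  simp [augmentation_apply, coeff_ofSeries]

theorem augmentation_eq_zero_of_mem_span {x P : ATilde} (hP : augmentation P = 0)
    (hx : x ∈ Submodule.span ATilde {P}) : augmentation x = 0 := by
  obtain ⟨y, rfl⟩ := Submodule.mem_span_singleton.1 hx
  rw [smul_eq_mul, map_mul, hP, mul_zero]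

/-! ### Division by `a - μ b` -/

/-- The left shift of the coefficients, a left inverse of left multiplication by `b`. -/
def shift (x : ATilde) : ATilde := .mk fun n => x.coeff (n + 1)

/-- The polynomial `P(a)` as an element of `Ã`. -/
noncomputable def ofPoly (P : ℂ[X]) : ATilde := .mk fun n => if n = 0 then P else 0

theorem coeff_ofPoly (P : ℂ[X]) (n : ℕ) : (ofPoly P).coeff n = if n = 0 then P else 0 := rfl

theorem b_mul_shift {x : ATilde} (hx : x.coeff 0 = 0) : b * shift x = x := by
  refine ext_coeff fun n => ?_
  cases n with
  | zero => rw [coeff_b_mul_zero, hx]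
  | succ n => rw [coeff_b_mul_succ, shift]

theorem ofPoly_add_b_mul_shift (x : ATilde) : ofPoly (x.coeff 0) + b * shift x = x := by
  refine ext_coeff fun n => ?_
  cases n with
  | zero => simp [coeff_add, coeff_ofPoly, coeff_b_mul_zero]
  | succ n => simp [coeff_add, coeff_ofPoly, coeff_b_mul_succ, shift]

/-- The next remainder in the division of `x` by `a - μ b` on the right. -/
noncomputable def divStep (μ : ℂ) (x : ATilde) : ATilde :=
  shift (x - ofPoly (x.coeff 0).divX * (a - μ • b) - ofPoly (Polynomial.C ((x.coeff 0).coeff 0)))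

/-- Modulo `b`, `a - μ b` is the variable `X`, so dividing the leading polynomial by `X` cancels the
whole coefficient of `b ^ 0`. -/
theorem b_mul_divStep (μ : ℂ) (x : ATilde) : b * divStep μ x =
    x - ofPoly (x.coeff 0).divX * (a - μ • b) - ofPoly (Polynomial.C ((x.coeff 0).coeff 0)) := by
  refine b_mul_shift ?_
  simp only [coeff_sub, coeff_mul_zero, coeff_ofPoly, coeff_smul, coeff_a, coeff_b, if_pos]
  simp only [zero_ne_one, if_false, smul_zero, sub_zero]
  rw [sub_sub, Polynomial.divX_mul_X_add, sub_self]

/-- Division by `a - μ b` on the right, with remainder in `ℂ[[b]]`. -/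
theorem exists_eq_mul_add_ofSeries (μ : ℂ) (x : ATilde) :
    ∃ (y : ATilde) (r : ℂ⟦X⟧), x = y * (a - μ • b) + ofSeries r := by
  let q : ATilde → ATilde := fun x => .mk fun n => (((divStep μ)^[n] x).coeff 0).divX
  let r : ATilde → ℂ⟦X⟧ := fun x => .mk fun n => (((divStep μ)^[n] x).coeff 0).coeff 0
  have hq (x) : q x = ofPoly (x.coeff 0).divX + b * q (divStep μ x) :=
    (ofPoly_add_b_mul_shift (q x)).symm
  have hr (x) : ofSeries (r x) = ofPoly (Polynomial.C ((x.coeff 0).coeff 0)) +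
      b * ofSeries (r (divStep μ x)) := by
    refine (ofPoly_add_b_mul_shift _).symm.trans ?_
    congr 2
    · simp [coeff_ofSeries, r]
    · refine ext_coeff fun n => ?_
      simp [coeff_ofSeries, r, shift]
  -- The division error of `x` is `b` times that of the next remainder, hence divisible by every
  -- power of `b`, hence zero.
  have key (x) : x - q x * (a - μ • b) - ofSeries (r x) =
      b * (divStep μ x - q (divStep μ x) * (a - μ • b) - ofSeries (r (divStep μ x))) := by
    rw [hq, hr, mul_sub b, mul_sub b, b_mul_divStep, add_mul, mul_assoc b]
    abel
  refine ⟨q x, r x, ?_⟩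
  rw [← sub_eq_zero, ← sub_sub]
  refine ext_coeff fun n => ?_
  induction n generalizing x with
  | zero => rw [key, coeff_b_mul_zero, coeff_zero]
  | succ n ih => rw [key, coeff_b_mul_succ, ih, coeff_zero, coeff_zero]

/-! ### The action of `a - ν b` on `E_μ` -/

theorem b_eq_ofSeries : b = ofSeries PowerSeries.X := by
  refine ext_coeff fun n => ?_
  rw [coeff_b, coeff_ofSeries, PowerSeries.coeff_X]
  split_ifs <;> simp

theorem smul_ofSeries (c : ℂ) (f : ℂ⟦X⟧) : c • ofSeries f = ofSeries (c • f) := by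
  refine ext_coeff fun n => ?_
  simp [coeff_smul, coeff_ofSeries, Polynomial.smul_C]

theorem ofSeries_C (c : ℂ) : ofSeries (PowerSeries.C c) = algebraMap ℂ ATilde c := by
  rw [Algebra.algebraMap_eq_smul_one, ← map_one ofSeries, smul_ofSeries,
    PowerSeries.smul_eq_C_mul, mul_one]

/-- Bracketing with `a` is the derivation `b² d/db`. Writing `f = X g + c`, the defect of the
formula at `f` is `b` times its defect at `g`, so it vanishes `b`-adically. -/
theorem a_mul_ofSeries (f : ℂ⟦X⟧) : a * ofSeries f =
    ofSeries f * a + ofSeries (PowerSeries.X ^ 2 * PowerSeries.derivative ℂ f) := by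
  have key (f : ℂ⟦X⟧) : ∃ g, a * ofSeries f - ofSeries f * a -
      ofSeries (PowerSeries.X ^ 2 * PowerSeries.derivative ℂ f) =
      b * (a * ofSeries g - ofSeries g * a -
        ofSeries (PowerSeries.X ^ 2 * PowerSeries.derivative ℂ g)) := by
    refine ⟨.mk fun n => PowerSeries.coeff (n + 1) f, ?_⟩
    set g : ℂ⟦X⟧ := .mk fun n => PowerSeries.coeff (n + 1) f
    have hf : f = PowerSeries.X * g + PowerSeries.C (PowerSeries.constantCoeff f) :=
      PowerSeries.eq_X_mul_shift_add_const f
    generalize PowerSeries.constantCoeff f = c at hf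
    have hder : PowerSeries.derivative ℂ f = g + PowerSeries.X * PowerSeries.derivative ℂ g := by
      rw [hf]
      simp [PowerSeries.derivative_C, PowerSeries.derivative_X, add_comm]
    have hab : a * b = b * a + b ^ 2 := by rw [← a_mul_b_sub_b_mul_a]; abel
    have habg : a * (b * ofSeries g) = b * (a * ofSeries g) + b ^ 2 * ofSeries g := by
      rw [← mul_assoc, hab]
      noncomm_ring
    rw [hder, hf]
    simp only [map_add, map_mul, map_pow, ← b_eq_ofSeries, ofSeries_C, mul_add, add_mul, habg,
      Algebra.commutes]
    noncomm_ring
  rw [← sub_eq_zero, ← sub_sub]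
  refine ext_coeff fun n => ?_
  induction n generalizing f with
  | zero =>
    obtain ⟨g, hg⟩ := key f
    rw [hg, coeff_b_mul_zero, coeff_zero]
  | succ n ih =>
    obtain ⟨g, hg⟩ := key f
    rw [hg, coeff_b_mul_succ, ih, coeff_zero, coeff_zero]

/-- The action of `a - ν b` on `ℂ[[b]] e`, where `a e = μ b e`. -/
theorem sub_smul_mul_ofSeries (μ ν : ℂ) (f : ℂ⟦X⟧) : (a - ν • b) * ofSeries f =
    ofSeries f * (a - μ • b) + ofSeries
      (PowerSeries.X ^ 2 * PowerSeries.derivative ℂ f + (μ - ν) • (PowerSeries.X * f)) := by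
  rw [sub_mul, a_mul_ofSeries, smul_mul_assoc, b_eq_ofSeries, ← map_mul, mul_sub, mul_smul_comm,
    ← map_mul, smul_ofSeries, smul_ofSeries, mul_comm f, sub_smul, map_add, map_sub]
  abel

/-- Reduces an equation in `E_μ` to a differential equation for power series. -/
theorem sub_smul_mul_ofSeries_sub_mem {μ ν : ℂ} {T f : ℂ⟦X⟧}
    (h : PowerSeries.X ^ 2 * PowerSeries.derivative ℂ T + (μ - ν) • (PowerSeries.X * T) = f) :
    (a - ν • b) * ofSeries T - ofSeries f ∈ Submodule.span ATilde {a - μ • b} := by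
  rw [sub_smul_mul_ofSeries μ ν, h, add_sub_cancel_right]
  exact Submodule.mem_span_singleton.2 ⟨ofSeries T, rfl⟩

/-- Solving `(a - ν b) T e = f e`, where `a e = μ b e`, above the resonances. -/
theorem exists_sub_smul_mul_ofSeries_sub_mem {μ ν : ℂ} {p : ℕ}
    (h : ∀ q : ℕ, p ≤ q → μ + q - ν ≠ 0) {f : ℂ⟦X⟧} (hf : PowerSeries.X ^ (p + 1) ∣ f) :
    ∃ T : ℂ⟦X⟧, PowerSeries.X ^ p ∣ T ∧
      (a - ν • b) * ofSeries T - ofSeries f ∈ Submodule.span ATilde {a - μ • b} := by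
  rw [PowerSeries.X_pow_dvd_iff] at hf
  -- The coefficient of `X ^ (q + 1)` reads `(μ + q - ν) T_q = f_(q+1)`. A zero denominator can
  -- occur only for `q < p`, where the numerator is zero as well.
  refine ⟨.mk fun q => PowerSeries.coeff (q + 1) f / (μ + q - ν), ?_, ?_⟩
  · rw [PowerSeries.X_pow_dvd_iff]
    intro q hq
    rw [PowerSeries.coeff_mk, hf _ (by omega), zero_div]
  · refine sub_smul_mul_ofSeries_sub_mem ?_
    ext m
    rw [map_add, PowerSeries.coeff_smul, pow_two, mul_assoc]
    cases m with
    | zero => rw [hf 0 (by omega), PowerSeries.coeff_zero_X_mul, PowerSeries.coeff_zero_X_mul, smul_zero,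
        add_zero]
    | succ m =>
      rw [PowerSeries.coeff_succ_X_mul, PowerSeries.coeff_succ_X_mul]
      have : PowerSeries.coeff m (PowerSeries.X * PowerSeries.derivative ℂ
          (.mk fun q => PowerSeries.coeff (q + 1) f / (μ + q - ν))) =
          m * (PowerSeries.coeff (m + 1) f / (μ + m - ν)) := by
        cases m with
        | zero => simp
        | succ m =>
          rw [PowerSeries.coeff_succ_X_mul]
          simp [PowerSeries.coeff_derivative, mul_comm]
      rw [this, PowerSeries.coeff_mk, smul_eq_mul]
      by_cases hm : p ≤ m
      · have := h m hm
        field_simp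
        ring
      · rw [hf (m + 1) (by omega)]
        simp

end ATilde

open ATilde

/-! ### Solving equations with `Π` -/

theorem piProd_zero (lam : Fin 1 → ℂ) (S : Fin 0 → ℂ[X]) :
    PiProd lam S = a - lam 0 • b := by
  simp [PiProd]

theorem piProd_succ {n : ℕ} (lam : Fin (n + 2) → ℂ) (S : Fin (n + 1) → ℂ[X]) :
    PiProd lam S = (a - lam 0 • b) * ofSeries ((S 0 : ℂ⟦X⟧)⁻¹) *
      PiProd (fun j => lam j.succ) (fun j => S j.succ) := by
  simp [PiProd, List.ofFn_succ, mul_assoc]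

theorem augmentation_piProd {n : ℕ} (lam : Fin (n + 1) → ℂ) (S : Fin n → ℂ[X]) :
    augmentation (PiProd lam S) = 0 := by
  rw [PiProd, map_mul, augmentation_sub_smul, mul_zero]

/-- Solving `Π T e = f e`, where `a e = μ b e`, above the resonances. -/
theorem exists_piProd_mul_ofSeries_sub_mem {μ : ℂ} {p n : ℕ} (lam : Fin (n + 1) → ℂ)
    (S : Fin n → ℂ[X]) (hS : ∀ j, (S j).eval 0 = 1)
    (h : ∀ j, ∀ q : ℕ, p ≤ q → μ + q - lam j ≠ 0)
    {f : ℂ⟦X⟧} (hf : PowerSeries.X ^ (p + n + 1) ∣ f) :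
    ∃ T : ℂ⟦X⟧, PowerSeries.X ^ p ∣ T ∧
      PiProd lam S * ofSeries T - ofSeries f ∈ Submodule.span ATilde {a - μ • b} := by
  induction n generalizing f with
  | zero =>
    rw [piProd_zero]
    exact exists_sub_smul_mul_ofSeries_sub_mem (h 0) hf
  | succ n ih =>
    -- The leftmost factor is inverted first, at the cost of one power of `X`. Multiplying `u` by
    -- the unit `S 0` undoes the inverse in `Π` without changing the order.
    obtain ⟨u, hu, hu'⟩ := exists_sub_smul_mul_ofSeries_sub_mem (p := p + (n + 1))
      (fun q hq => h 0 q (by omega)) hf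
    obtain ⟨T, hT, hT'⟩ := ih (fun j => lam j.succ) (fun j => S j.succ) (fun j => hS j.succ)
      (fun j => h j.succ) (f := (S 0 : ℂ⟦X⟧) * u) (hu.mul_left _)
    refine ⟨T, hT, ?_⟩
    have h0 : ofSeries ((S 0 : ℂ⟦X⟧)⁻¹) * ofSeries ((S 0 : ℂ⟦X⟧) * u) = ofSeries u := by
      rw [← map_mul, ← mul_assoc, PowerSeries.inv_mul_cancel, one_mul]
      simp [← Polynomial.coeff_zero_eq_eval_zero] at hS ⊢
      simp [hS]
    have := Submodule.add_mem _ (Submodule.smul_mem _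
      ((a - lam 0 • b) * ofSeries ((S 0 : ℂ⟦X⟧)⁻¹)) hT') hu'
    rw [smul_eq_mul, mul_sub, mul_assoc _ (ofSeries _) (ofSeries (_ * u)), h0] at this
    rw [piProd_succ]
    convert this using 1
    noncomm_ring

/-! ### The exponents `m_j` -/

theorem le_mExp {k : ℕ} (lam : Fin k → ℂ) {j h : Fin k} (hjh : j < h) {p : ℕ}
    (hp : lam h - lam j = p) : (p : ℤ) ≤ mExp lam j := by
  have hmem : p ∈ {p : ℕ | ∃ h : Fin k, j < h ∧ lam h - lam j = p} := ⟨h, hjh, hp⟩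
  rw [mExp, if_pos ⟨p, hmem⟩]
  refine Nat.cast_le.2 (le_csSup (Set.Finite.bddAbove ?_) hmem)
  -- Boundedness is what makes the `sSup` in ℕ a true supremum.
  have hfin : (Set.range fun h => lam h - lam j).Finite := Set.finite_range _
  refine (hfin.preimage (f := ((↑) : ℕ → ℂ)) Nat.cast_injective.injOn).subset ?_
  rintro q ⟨h, -, hq⟩
  exact ⟨h, hq⟩

theorem neg_one_le_mExp {k : ℕ} (lam : Fin k → ℂ) (j : Fin k) : -1 ≤ mExp lam j := by
  unfold mExp
  split_ifs <;> omega

theorem mExp_eq_neg_one {k : ℕ} (lam : Fin k → ℂ) (j : Fin k)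
    (hj : ∀ h, j < h → ∀ p : ℕ, lam j ≠ lam h - p) : mExp lam j = -1 := by
  rw [mExp, if_neg]
  rintro ⟨p, h, hjh, hp⟩
  exact hj h hjh p (by rw [← hp]; ring)

theorem mExp_succ {k : ℕ} (lam : Fin (k + 1) → ℂ) (j : Fin k) :
    mExp lam j.succ = mExp (fun i => lam i.succ) j := by
  have : {p : ℕ | ∃ h : Fin (k + 1), j.succ < h ∧ lam h - lam j.succ = p} =
      {p : ℕ | ∃ h : Fin k, j < h ∧ lam h.succ - lam j.succ = p} := by
    ext p
    simp [Fin.exists_fin_succ]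
  rw [mExp, mExp, this]

/-! ### Lifting generators along the Jordan–Hölder series -/

section

variable {E : Type*} [AddCommGroup E] [Module ATilde E]

/-- A subquotient isomorphic to `Ã / Ã P` has a generator with annihilator `Ã P`. -/
theorem exists_generator_of_quotient_equiv {F' F : Submodule ATilde E} {P : ATilde}
    (φ : (F ⧸ F'.submoduleOf F) ≃ₗ[ATilde] QuotBy P) :
    ∃ e ∈ F, (∀ f ∈ F, ∃ x : ATilde, f - x • e ∈ F') ∧
      ∀ x : ATilde, x • e ∈ F' ↔ x ∈ Submodule.span ATilde {P} := by
  obtain ⟨e, he⟩ := Submodule.mkQ_surjective (F'.submoduleOf F)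
    (φ.symm (Submodule.Quotient.mk 1))
  rw [Submodule.mkQ_apply] at he
  have key (x : ATilde) :
      φ (Submodule.Quotient.mk (x • e)) = Submodule.Quotient.mk x := by
    rw [Submodule.Quotient.mk_smul, map_smul, he, LinearEquiv.apply_symm_apply,
      ← Submodule.Quotient.mk_smul, smul_eq_mul, mul_one]
  refine ⟨e, e.2, fun f hf => ?_, fun x => ?_⟩
  · obtain ⟨x, hx⟩ := Submodule.Quotient.mk_surjective _
      (φ (Submodule.Quotient.mk (⟨f, hf⟩ : F)))
    rw [← key, EmbeddingLike.apply_eq_iff_eq, eq_comm, Submodule.Quotient.eq] at hx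
    exact ⟨x, hx⟩
  · rw [← Submodule.Quotient.mk_eq_zero (Submodule.span ATilde {P}), ← key,
      EmbeddingLike.map_eq_zero_iff, Submodule.Quotient.mk_eq_zero]
    rfl

/-- In a cyclic module, the generator of `F₁ / F₀ ≃ E_μ` may be chosen such that `P • e` is
congruent to `S • f` with `S` a series of constant term `1`. -/
theorem exists_generator_normalized {F₀ F₁ : Submodule ATilde E} {P : ATilde} {μ : ℂ} {e g : E}
    (φ : (F₁ ⧸ F₀.submoduleOf F₁) ≃ₗ[ATilde] ELam μ)
    (hg : ∀ y : E, ∃ x : ATilde, y = x • g)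
    (hP : augmentation P = 0) (hgen : ∀ y : E, ∃ x : ATilde, y - x • e ∈ F₁)
    (hann : ∀ x : ATilde, x • e ∈ F₁ ↔ x ∈ Submodule.span ATilde {P}) :
    ∃ f ∈ F₁, ∃ S : ℂ⟦X⟧, PowerSeries.constantCoeff S = 1 ∧
      (∀ y ∈ F₁, ∃ x : ATilde, y - x • f ∈ F₀) ∧
      (∀ x : ATilde, x • f ∈ F₀ ↔ x ∈ Submodule.span ATilde {a - μ • b}) ∧
      P • e - ofSeries S • f ∈ F₀ := by
  obtain ⟨f, hf, hfgen, hfann⟩ := exists_generator_of_quotient_equiv φ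
  have hPe : P • e ∈ F₁ := (hann P).2 (Submodule.mem_span_singleton_self P)
  obtain ⟨s, hs⟩ := hfgen _ hPe
  obtain ⟨y, S, rfl⟩ := exists_eq_mul_add_ofSeries μ s
  have hS : P • e - ofSeries S • f ∈ F₀ := by
    have h1 : (y * (a - μ • b)) • f ∈ F₀ :=
      (hfann _).2 (Submodule.mem_span_singleton.2 ⟨y, rfl⟩)
    convert F₀.add_mem hs h1 using 1
    simp only [add_smul, sub_smul, smul_sub, mul_smul]
    abel
  -- To see that `S` is a unit, write `f = x g`, `e = u g` and `g = v e + t f` modulo `F₀`. Modulo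
  -- `F₁` this shows that `u` and `v` have nonzero augmentation, while that of `x` is zero.
  obtain ⟨x, hx⟩ := hg f
  obtain ⟨u, hu⟩ := hg e
  obtain ⟨v, hv⟩ := hgen g
  obtain ⟨t, ht⟩ := hfgen _ hv
  have hε {z : ATilde} (hz : z • e ∈ F₁) : augmentation z = 0 :=
    augmentation_eq_zero_of_mem_span hP ((hann z).1 hz)
  have huv : augmentation u * augmentation v = 1 := by
    rw [← map_mul, eq_comm, ← sub_eq_zero, ← map_one augmentation, ← map_sub]
    refine hε ?_
    convert F₁.smul_mem u hv using 1
    rw [smul_sub, ← hu]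
    simp only [sub_smul, mul_smul, one_smul]
  have hxv : augmentation x * augmentation v = 0 := by
    rw [← map_mul]
    refine hε ?_
    convert F₁.sub_mem hf (F₁.smul_mem x hv) using 1
    rw [smul_sub, ← hx]
    simp only [mul_smul]
    abel
  have hx0 : augmentation x = 0 :=
    (mul_eq_zero.1 hxv).resolve_right (right_ne_zero_of_mul_eq_one huv)
  have hxve : (x * v) • e ∈ F₁ := by
    convert F₁.sub_mem hf (F₁.smul_mem x hv) using 1
    rw [smul_sub, ← hx]
    simp only [mul_smul]
    abel
  obtain ⟨z, hz⟩ := Submodule.mem_span_singleton.1 ((hann _).1 hxve)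
  -- From `f = x g = x v e + x t f` and `x v = z P`. Taking augmentations leaves `1 = ε(z) S(0)`.
  have hmem : (1 - x * t - z * ofSeries S) • f ∈ F₀ := by
    have hz' : z • P • e = x • v • e := by rw [smul_smul, smul_smul, ← hz, smul_eq_mul]
    convert F₀.add_mem (F₀.smul_mem x ht) (F₀.smul_mem z hS) using 1
    rw [smul_sub, smul_sub, smul_sub, ← hx, hz']
    simp only [sub_smul, mul_smul, one_smul]
    abel
  have hone := augmentation_eq_zero_of_mem_span (augmentation_sub_smul μ) ((hfann _).1 hmem)
  rw [map_sub, map_sub, map_mul, map_mul, hx0, zero_mul, sub_zero, map_one,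
    augmentation_ofSeries, sub_eq_zero] at hone
  set c := PowerSeries.constantCoeff S with hc
  have hc0 : c ≠ 0 := right_ne_zero_of_mul_eq_one hone.symm
  have hcc : ofSeries (PowerSeries.C c⁻¹) * ofSeries (PowerSeries.C c) = 1 := by
    rw [← map_mul, ← map_mul, inv_mul_cancel₀ hc0, map_one, map_one]
  have hcc' : ofSeries (PowerSeries.C c) * ofSeries (PowerSeries.C c⁻¹) = 1 := by
    rw [← map_mul, ← map_mul, mul_inv_cancel₀ hc0, map_one, map_one]
  have hcomm (d : ℂ) (w : ATilde) : w * ofSeries (PowerSeries.C d) =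
      ofSeries (PowerSeries.C d) * w := by
    rw [ofSeries_C, Algebra.commutes]
  refine ⟨ofSeries (PowerSeries.C c) • f, F₁.smul_mem _ hf, PowerSeries.C c⁻¹ * S, ?_, ?_, ?_, ?_⟩
  · simp [← hc, hc0]
  · intro y hy
    obtain ⟨x, hx⟩ := hfgen y hy
    refine ⟨x * ofSeries (PowerSeries.C c⁻¹), ?_⟩
    rwa [smul_smul, mul_assoc, hcc, mul_one]
  · intro x
    rw [← hfann, smul_smul, hcomm, mul_smul]
    refine ⟨fun h => ?_, F₀.smul_mem _⟩
    have := F₀.smul_mem (ofSeries (PowerSeries.C c⁻¹)) h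
    rwa [smul_smul, hcc, one_smul] at this
  · rwa [smul_smul, mul_comm, map_mul, mul_assoc, hcc, mul_one]

/-- The main theorem relative to a submodule `F 0`, for a cyclic module. -/
theorem exists_generator_piProd {n : ℕ} {g : E} (hg : ∀ y : E, ∃ x : ATilde, y = x • g)
    (F : Fin (n + 2) → Submodule ATilde E) (lam : Fin (n + 1) → ℂ)
    (htop : F (Fin.last (n + 1)) = ⊤) (hle : ∀ j : Fin (n + 1), F j.castSucc ≤ F j.succ)
    (hquot : ∀ j : Fin (n + 1), Nonempty
      ((F j.succ ⧸ (F j.castSucc).submoduleOf (F j.succ)) ≃ₗ[ATilde] ELam (lam j))) :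
    ∃ S : Fin n → ℂ[X], (∀ j, (S j).eval 0 = 1) ∧
      (∀ j : Fin n, ((S j).natDegree : ℤ) ≤ n - j + mExp lam j.castSucc) ∧
      ∃ e : E, (∀ y : E, ∃ x : ATilde, y - x • e ∈ F 0) ∧
        ∀ x : ATilde, x • e ∈ F 0 ↔ x ∈ Submodule.span ATilde {PiProd lam S} := by
  induction n with
  | zero =>
    obtain ⟨φ⟩ := hquot 0
    obtain ⟨e, -, hgen, hann⟩ := exists_generator_of_quotient_equiv φ
    refine ⟨Fin.elim0, fun j => j.elim0, fun j => j.elim0, e, fun y => ?_, fun x => ?_⟩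
    · exact hgen y (by rw [show (Fin.succ 0 : Fin 2) = Fin.last 1 from rfl, htop]; trivial)
    · rw [piProd_zero]
      exact hann x
  | succ n ih =>
    -- Dropping `F 0` from the chain handles `E / F 1` without leaving `E`.
    obtain ⟨S, hS0, hSdeg, e, hgen, hann⟩ := ih (fun j => F j.succ) (fun j => lam j.succ)
      htop (fun j => hle j.succ) (fun j => hquot j.succ)
    obtain ⟨φ⟩ := hquot 0
    obtain ⟨f, hf, U, hU, hfgen, hfann, hPe⟩ := exists_generator_normalized φ hg
      (augmentation_piProd _ S) hgen hann
    set P := PiProd (fun j => lam j.succ) S with hP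
    -- The first order beyond all resonances; it is `0` when there are none.
    obtain ⟨p, hp⟩ : ∃ p : ℕ, (p : ℤ) = mExp lam 0 + 1 :=
      ⟨(mExp lam 0 + 1).toNat, Int.toNat_of_nonneg (by linarith [neg_one_le_mExp lam 0])⟩
    set V : ℂ[X] := PowerSeries.trunc (p + n + 1) U with hV
    have hV0 : V.coeff 0 = 1 := by
      rw [hV, PowerSeries.coeff_trunc, if_pos (by omega), PowerSeries.coeff_zero_eq_constantCoeff,
        hU]
    have hVU : PowerSeries.X ^ (p + n + 1) ∣ (V : ℂ⟦X⟧) - U := by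
      rw [PowerSeries.X_pow_dvd_iff]
      intro m hm
      rw [map_sub, Polynomial.coeff_coe, hV, PowerSeries.coeff_trunc, if_pos hm, sub_self]
    -- `T` is chosen so that `P T f = (V - U) f` modulo `F 0`, which turns `P e = U f` into `P (e +
    -- T f) = V f`.
    obtain ⟨T, -, hT⟩ := exists_piProd_mul_ofSeries_sub_mem (μ := lam 0) (p := p)
      (fun j => lam j.succ) S hS0 (fun j q hq h0 => by
        have := le_mExp lam (Fin.succ_pos j) (p := q) (by linear_combination -h0)
        omega) hVU
    have hVinv : ofSeries (V : ℂ⟦X⟧) * ofSeries (V : ℂ⟦X⟧)⁻¹ = 1 := by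
      rw [← map_mul, PowerSeries.mul_inv_cancel, map_one]
      simp [hV0]
    have hVinv' : ofSeries (V : ℂ⟦X⟧)⁻¹ * ofSeries (V : ℂ⟦X⟧) = 1 := by
      rw [← map_mul, mul_comm, map_mul, hVinv]
    have hPe' : P • (e + ofSeries T • f) - ofSeries (V : ℂ⟦X⟧) • f ∈ F 0 := by
      convert (F 0).add_mem hPe ((hfann _).2 hT) using 1
      rw [map_sub]
      simp only [sub_smul, smul_add, mul_smul]
      abel
    have hTf (x : ATilde) : (x * ofSeries T) • f ∈ F (Fin.succ 0) :=
      (F (Fin.succ 0)).smul_mem _ hf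
    have hprod : PiProd lam (Fin.cons V S : Fin (n + 1) → ℂ[X]) =
        (a - lam 0 • b) * ofSeries (V : ℂ⟦X⟧)⁻¹ * P := by
      rw [piProd_succ]
      rfl
    refine ⟨Fin.cons V S, ?_, ?_, e + ofSeries T • f, ?_, ?_⟩
    · refine Fin.cases ?_ hS0
      rw [Fin.cons_zero, ← Polynomial.coeff_zero_eq_eval_zero, hV0]
    · refine Fin.cases ?_ fun j => ?_
      · have := PowerSeries.natDegree_trunc_lt U (p + n)
        rw [← hV] at this
        rw [Fin.cons_zero, Fin.castSucc_zero, Fin.val_zero]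
        push_cast
        omega
      · have := hSdeg j
        rw [← mExp_succ] at this
        rw [Fin.cons_succ, ← Fin.succ_castSucc, Fin.val_succ]
        push_cast
        linarith
    · intro y
      obtain ⟨x, hx⟩ := hgen y
      have hx' : y - x • (e + ofSeries T • f) ∈ F (Fin.succ 0) := by
        convert (F (Fin.succ 0)).sub_mem hx (hTf x) using 1
        simp only [smul_add, mul_smul]
        abel
      obtain ⟨z, hz⟩ := hfgen _ hx'
      -- The remainder `z f` is expressed through the new generator by `f = V⁻¹ P (e + T f)` modulo
      -- `F 0`.
      refine ⟨x + z * ofSeries (V : ℂ⟦X⟧)⁻¹ * P, ?_⟩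
      have h1 := (F 0).smul_mem (z * ofSeries (V : ℂ⟦X⟧)⁻¹) hPe'
      rw [smul_sub, smul_smul _ (ofSeries _) f, mul_assoc z, hVinv', mul_one] at h1
      convert (F 0).sub_mem hz h1 using 1
      simp only [add_smul, smul_add, mul_smul]
      abel
    · intro x
      rw [hprod, Submodule.mem_span_singleton]
      constructor
      · intro hx
        have hxe : x • e ∈ F (Fin.succ 0) := by
          convert (F (Fin.succ 0)).sub_mem (hle 0 hx) (hTf x) using 1
          simp only [smul_add, mul_smul]
          abel
        -- Now `x = y P`, so `y V` kills `f` modulo `F 0`; hence `y V = z (a - lam 0 b)` and `x = z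
        -- (a - lam 0 b) V⁻¹ P`.
        obtain ⟨y, rfl⟩ := Submodule.mem_span_singleton.1 ((hann x).1 hxe)
        have h1 : (y * ofSeries (V : ℂ⟦X⟧)) • f ∈ F 0 := by
          convert (F 0).sub_mem hx ((F 0).smul_mem y hPe') using 1
          rw [smul_eq_mul]
          simp only [smul_add, smul_sub, mul_smul]
          abel
        obtain ⟨z, hz⟩ := Submodule.mem_span_singleton.1 ((hfann _).1 h1)
        refine ⟨z, ?_⟩
        rw [smul_eq_mul, ← mul_assoc, ← mul_assoc, ← smul_eq_mul (a := z), hz, mul_assoc y,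
          hVinv, mul_one, smul_eq_mul]
      · rintro ⟨z, rfl⟩
        have h1 := (F 0).smul_mem (z * (a - lam 0 • b) * ofSeries (V : ℂ⟦X⟧)⁻¹) hPe'
        rw [smul_sub, smul_smul _ (ofSeries _) f, mul_assoc (z * _), hVinv', mul_one] at h1
        have h2 : (z * (a - lam 0 • b)) • f ∈ F 0 :=
          (hfann _).2 (Submodule.mem_span_singleton.2 ⟨z, rfl⟩)
        convert (F 0).add_mem h1 h2 using 1
        rw [smul_eq_mul, ← mul_assoc, ← mul_assoc]
        simp only [sub_smul, smul_add, smul_sub, mul_smul]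
        abel

end

/-- The rank is `k = n + 1` and the indices `1, …, k` of the `λ`'s are shifted to `0, …, n`: for
`j : Fin n` the bounds `n - j + m_j` and `n - j - 1` are `k - (j + 1) + m` and
`k - (j + 1) - 1`. -/
theorem mainTheorem2 {E : Type*} [AddCommGroup E] [Module ATilde E] {n : ℕ}
    (hreg : IsRegularABModule E) (hmono : IsMonogenic E)
    (F : Fin (n + 2) → Submodule ATilde E) (lam : Fin (n + 1) → ℂ)
    (hF : IsJordanHolderSeries F lam) :
    ∃ S : Fin n → ℂ[X],
      (∀ j, (S j).eval 0 = 1) ∧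
      (∀ j : Fin n, ((S j).natDegree : ℤ) ≤ n - j + mExp lam j.castSucc) ∧
      (∀ j : Fin n,
        (∀ h : Fin (n + 1), j.castSucc < h → ∀ p : ℕ, lam j.castSucc ≠ lam h - p) →
          ((S j).natDegree : ℤ) ≤ n - j - 1) ∧
      Nonempty (E ≃ₗ[ATilde] QuotBy (PiProd lam S)) := by
  obtain ⟨I, ⟨φ⟩⟩ := hmono
  have hg (y : E) : ∃ x : ATilde, y = x • φ.symm (Submodule.Quotient.mk 1) := by
    obtain ⟨x, hx⟩ := Submodule.Quotient.mk_surjective _ (φ y)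
    refine ⟨x, ?_⟩
    rw [← map_smul, ← Submodule.Quotient.mk_smul, smul_eq_mul, mul_one, hx,
      LinearEquiv.symm_apply_apply]
  obtain ⟨S, hS0, hSdeg, e, hgen, hann⟩ :=
    exists_generator_piProd hg F lam hF.top hF.le hF.quot
  refine ⟨S, hS0, hSdeg, fun j hj => ?_, ?_⟩
  · have := hSdeg j
    rwa [mExp_eq_neg_one lam _ hj] at this
  · rw [hF.bot] at hgen hann
    have hsurj : Function.Surjective (LinearMap.toSpanSingleton ATilde E e) := fun y => by
      obtain ⟨x, hx⟩ := hgen y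
      exact ⟨x, (sub_eq_zero.1 ((Submodule.mem_bot _).1 hx)).symm⟩
    have hker : LinearMap.ker (LinearMap.toSpanSingleton ATilde E e) =
        Submodule.span ATilde {PiProd lam S} := by
      ext x
      rw [LinearMap.mem_ker, LinearMap.toSpanSingleton_apply, ← hann, Submodule.mem_bot]
    exact ⟨((Submodule.quotEquivOfEq _ _ hker).symm.trans
      (LinearMap.quotKerEquivOfSurjective _ hsurj)).symm⟩
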